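/- Let $\gamma$ and $\Gamma$ be circles in the Euclidean plane with radii $r$ and $R$ respectively, such that $\gamma$ is contained in the open disk bounded by $\Gamma$. A Steiner $4$-chain with parent circles $\gamma,\Gamma$ is a sequence of four distinct circles $\delta_1,\delta_2,\delta_3,\delta_4$ such that $\delta_i$ and $\delta_{i+1}$ are externally tangent for each $i$ (indices modulo $4$), and each $\delta_i$ is externally tangent to $\gamma$ and internally tangent to $\Gamma$. The poristic family of $\gamma,\Gamma$ is the collection of all Steiner $4$-chains with these parent circles. Put $a=\frac1r$ and $A=-\frac1R$. Then the first three moments $I_k=\sum_{j=1}^4 b_j^k$ ($k=1,2,3$) of the curvatures $b_j$ of the circles $\delta_j$ ($b_j$ being the reciprocal of the radius of $\delta_j$) have the same values for all chains of the poristic family, namely $$I_1=\frac{2(R-r)}{Rr}=2(A+a),$$ $$I_2=\frac{3R^2-10Rr+3r^2}{2R^2r^2}=\frac{3A^2+10Aa+3a^2}{2},$$ $$I_3=\frac{5R^3-27R^2r+27Rr^2-5r^3}{4R^3r^3}=\frac{5A^3+27A^2a+27Aa^2+5a^3}{4}.$$ -/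

import Mathlib

open EuclideanGeometry

/-- Circles of the Euclidean plane, given by centre and radius. Mathlib does not ask the radius of a
sphere to be positive; positivity is required in `IsSteinerChain`. -/
abbrev PlaneCircle : Type := Sphere (EuclideanSpace ℝ (Fin 2))

/-- `δ 0, …, δ (n-1)` is a Steiner `n`-chain with parent circles `γ` (inner) and `Γ` (outer):
`γ` lies in the open disk bounded by `Γ`; the `δ i` are distinct genuine circles, each externally
tangent to `γ` and internally tangent to `Γ`; circles with adjacent indices modulo `n` are
externally tangent (addition in `Fin n` is modulo `n`). -/
structure IsSteinerChain {n : ℕ} [NeZero n] (γ Γ : PlaneCircle) (δ : Fin n → PlaneCircle) :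
    Prop where
  inner_radius_pos : 0 < γ.radius
  outer_radius_pos : 0 < Γ.radius
  nested : Metric.sphere γ.center γ.radius ⊆ Metric.ball Γ.center Γ.radius
  radius_pos : ∀ i, 0 < (δ i).radius
  distinct : Function.Injective δ
  tangent_next : ∀ i, (δ i).IsExtTangent (δ (i + 1))
  tangent_inner : ∀ i, (δ i).IsExtTangent γ
  tangent_outer : ∀ i, (δ i).IsIntTangent Γ

/-- The poristic family of Steiner `n`-chains: all Steiner `n`-chains with the given parents. -/
def poristicFamily (n : ℕ) [NeZero n] (γ Γ : PlaneCircle) : Set (Fin n → PlaneCircle) :=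
  {δ | IsSteinerChain γ Γ δ}

/-- The `k`-th moment of the curvatures `1 / (radius)` of a chain. -/
noncomputable def curvatureMoment {n : ℕ} (k : ℕ) (δ : Fin n → PlaneCircle) : ℝ :=
  ∑ j, (1 / (δ j).radius) ^ k

/-! Oriented circles are unit vectors of a Lorentz space; giving `Γ` negative radius turns every
tangency of the chain into a product `-1`. Hence `g + G`, `g - G`, `d₀ - d₂`, `d₁ - d₃` are pairwise
orthogonal. Nesting makes `g + G` timelike, so the two differences of opposite circles are spacelike
and the four vectors form an orthogonal basis.

Parseval in this basis forces the products of `g, G`, of `d₀, d₂` and of `d₁, d₃` to be `-3`.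
Applied to the null vector that reads off curvature, it fixes the sum of each opposite pair and the
total of the two products of opposite curvatures. The first three moments depend only on these. -/

/-- The Lorentz form on `ℝ⁴` in which oriented circles are unit vectors:
`⟪u, v⟫ = u₂v₂ + u₃v₃ - (u₀v₁ + u₁v₀) / 2`. -/
noncomputable def lorentzForm : LinearMap.BilinForm ℝ (Fin 4 → ℝ) :=
  Matrix.toBilin' !![0, -1 / 2, 0, 0; -1 / 2, 0, 0, 0; 0, 0, 1, 0; 0, 0, 0, 1]

lemma lorentzForm_apply (u v : Fin 4 → ℝ) :
    lorentzForm u v = u 2 * v 2 + u 3 * v 3 - (u 0 * v 1 + u 1 * v 0) / 2 := by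
  simp [lorentzForm, Matrix.toBilin'_apply, Fin.sum_univ_four]
  ring

lemma lorentzForm_comm (u v : Fin 4 → ℝ) : lorentzForm u v = lorentzForm v u := by
  simp only [lorentzForm_apply]
  ring

/-- A nonzero vector orthogonal to a timelike vector is spacelike. -/
lemma lorentzForm_self_pos_of_ortho {p w : Fin 4 → ℝ} (hp : lorentzForm p p < 0)
    (h : lorentzForm p w = 0) (hw : w ≠ 0) : 0 < lorentzForm w w := by
  rw [lorentzForm_apply] at hp h ⊢
  by_contra! hle
  apply hw
  -- Otherwise Cauchy–Schwarz in coordinates 2 and 3, the two causal inequalities and AM-GM give `(p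
  -- 2 * w 3 - p 3 * w 2) ^ 2 ≥ 0` and `(p 0 * w 1 + p 1 * w 0) ^ 2 / 4 ≥ p 0 * p 1 * w 0 * w 1`,
  -- contradicting orthogonality.
  have hprod : w 0 * w 1 ≤ 0 := by
    by_contra! hpos
    nlinarith [sq_nonneg (p 2 * w 3 - p 3 * w 2), sq_nonneg (p 0 * w 1 - p 1 * w 0),
      mul_nonneg (add_nonneg (sq_nonneg (p 2)) (sq_nonneg (p 3)))
        (show 0 ≤ w 0 * w 1 - (w 2 ^ 2 + w 3 ^ 2) by nlinarith),
      mul_pos hpos (show 0 < p 0 * p 1 - (p 2 ^ 2 + p 3 ^ 2) by nlinarith),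
      congrArg (· ^ 2) (show p 2 * w 2 + p 3 * w 3 = (p 0 * w 1 + p 1 * w 0) / 2 by linarith)]
  have h2 : w 2 = 0 := by nlinarith [sq_nonneg (w 2), sq_nonneg (w 3)]
  have h3 : w 3 = 0 := by nlinarith [sq_nonneg (w 2), sq_nonneg (w 3)]
  rw [h2, h3] at h hle
  have hzero : w 0 * w 1 = 0 := by linarith
  have hp01 : 0 < p 0 * p 1 := by nlinarith [sq_nonneg (p 2), sq_nonneg (p 3)]
  have hp0 : p 0 ≠ 0 := left_ne_zero_of_mul hp01.ne'
  have hp1 : p 1 ≠ 0 := right_ne_zero_of_mul hp01.ne'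
  have hlin : p 0 * w 1 + p 1 * w 0 = 0 := by linarith
  have h01 : w 0 = 0 ∧ w 1 = 0 := by
    rcases mul_eq_zero.1 hzero with h0 | h1
    · exact ⟨h0, by simpa [h0, hp0] using hlin⟩
    · exact ⟨by simpa [h1, hp1] using hlin, h1⟩
  ext i
  fin_cases i <;> simp [h01, h2, h3]

/-- Parseval's identity for a bilinear form and an orthogonal basis of anisotropic vectors. -/
lemma LinearMap.BilinForm.apply_eq_sum_of_iIsOrtho {K V ι : Type*} [Field K] [AddCommGroup V]
    [Module K V] [Fintype ι] [Nonempty ι] {B : LinearMap.BilinForm K V} {e : ι → V}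
    (he : B.iIsOrtho e) (hne : ∀ i, B (e i) (e i) ≠ 0)
    (hcard : Fintype.card ι = Module.finrank K V) (x y : V) :
    B x y = ∑ i, B x (e i) * B (e i) y / B (e i) (e i) := by
  classical
  have hli := LinearMap.BilinForm.linearIndependent_of_iIsOrtho he hne
  let b := basisOfLinearIndependentOfCardEqFinrank hli hcard
  have hx : x = ∑ i, b.repr x i • e i := by
    conv_lhs => rw [← b.sum_repr x]
    simp [b]
  have hcoef : ∀ i, B x (e i) = b.repr x i * B (e i) (e i) := by
    intro i
    conv_lhs => rw [hx]
    rw [LinearMap.BilinForm.sum_left, Finset.sum_eq_single i]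
    · simp
    · intro j _ hj
      have : B (e j) (e i) = 0 := he hj
      simp [this]
    · simp
  conv_lhs => rw [hx]
  rw [LinearMap.BilinForm.sum_left]
  refine Finset.sum_congr rfl fun i _ ↦ ?_
  rw [hcoef i, LinearMap.BilinForm.smul_left, mul_right_comm, mul_div_cancel_right₀ _ (hne i)]

/-- The Lorentz vector of the circle with centre `c` and signed radius `ρ`. -/
noncomputable def circleVec (c : EuclideanSpace ℝ (Fin 2)) (ρ : ℝ) : Fin 4 → ℝ :=
  ![1 / ρ, (c 0 ^ 2 + c 1 ^ 2) / ρ - ρ, c 0 / ρ, c 1 / ρ]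

/-- The product depends only on radii and distance of centres, so tangency and nesting become
conditions on inner products. -/
lemma lorentzForm_circleVec (c c' : EuclideanSpace ℝ (Fin 2)) {ρ ρ' : ℝ} (hρ : ρ ≠ 0)
    (hρ' : ρ' ≠ 0) :
    lorentzForm (circleVec c ρ) (circleVec c' ρ') =
      (ρ ^ 2 + ρ' ^ 2 - dist c c' ^ 2) / (2 * ρ * ρ') := by
  rw [EuclideanSpace.dist_sq_eq]
  simp only [lorentzForm_apply, circleVec, Fin.sum_univ_two, Real.dist_eq, sq_abs,
    Matrix.cons_val]
  field_simp
  ring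

lemma lorentzForm_circleVec_self (c : EuclideanSpace ℝ (Fin 2)) {ρ : ℝ} (hρ : ρ ≠ 0) :
    lorentzForm (circleVec c ρ) (circleVec c ρ) = 1 := by
  rw [lorentzForm_circleVec c c hρ hρ, dist_self]
  field_simp
  ring

lemma lorentzForm_circleVec_of_dist_eq_add {c c' : EuclideanSpace ℝ (Fin 2)} {ρ ρ' : ℝ}
    (hρ : ρ ≠ 0) (hρ' : ρ' ≠ 0) (h : dist c c' = ρ + ρ') :
    lorentzForm (circleVec c ρ) (circleVec c' ρ') = -1 := by
  rw [lorentzForm_circleVec c c' hρ hρ', h]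
  field_simp
  ring

lemma circleVec_injective {c c' : EuclideanSpace ℝ (Fin 2)} {ρ ρ' : ℝ} (hρ : ρ ≠ 0)
    (h : circleVec c ρ = circleVec c' ρ') : c = c' ∧ ρ = ρ' := by
  have h0 := congrFun h 0
  have h2 := congrFun h 2
  have h3 := congrFun h 3
  simp only [circleVec, Matrix.cons_val, one_div, inv_inj] at h0 h2 h3
  subst h0
  rw [div_left_inj' hρ] at h2 h3
  refine ⟨?_, rfl⟩
  ext i
  fin_cases i <;> assumption

/-- Parseval's identity for an orthogonal basis of the Lorentz form, with the basis given as four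
vectors. -/
lemma lorentzForm_eq_of_ortho {p m w z : Fin 4 → ℝ} (hpp : lorentzForm p p ≠ 0)
    (hmm : lorentzForm m m ≠ 0) (hww : lorentzForm w w ≠ 0) (hzz : lorentzForm z z ≠ 0)
    (hpm : lorentzForm p m = 0) (hpw : lorentzForm p w = 0) (hpz : lorentzForm p z = 0)
    (hmw : lorentzForm m w = 0) (hmz : lorentzForm m z = 0) (hwz : lorentzForm w z = 0)
    (x y : Fin 4 → ℝ) :
    lorentzForm x y =
      lorentzForm x p * lorentzForm y p / lorentzForm p p +
      lorentzForm x m * lorentzForm y m / lorentzForm m m +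
      lorentzForm x w * lorentzForm y w / lorentzForm w w +
      lorentzForm x z * lorentzForm y z / lorentzForm z z := by
  have hortho : lorentzForm.iIsOrtho ![p, m, w, z] := by
    intro i j hij
    fin_cases i <;> fin_cases j <;>
      first
      | exact absurd rfl hij
      | exact hpm
      | exact hpw
      | exact hpz
      | exact hmw
      | exact hmz
      | exact hwz
      | exact (lorentzForm_comm _ _).trans hpm
      | exact (lorentzForm_comm _ _).trans hpw
      | exact (lorentzForm_comm _ _).trans hpz
      | exact (lorentzForm_comm _ _).trans hmw
      | exact (lorentzForm_comm _ _).trans hmz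
      | exact (lorentzForm_comm _ _).trans hwz
  have hne : ∀ i, lorentzForm (![p, m, w, z] i) (![p, m, w, z] i) ≠ 0 := by
    intro i
    fin_cases i <;> assumption
  rw [LinearMap.BilinForm.apply_eq_sum_of_iIsOrtho hortho hne (by simp) x y, Fin.sum_univ_four,
    lorentzForm_comm y p, lorentzForm_comm y m, lorentzForm_comm y w, lorentzForm_comm y z]
  rfl

/-- The relations between the zeroth coordinates of six Lorentz vectors with the inner products of
a Steiner `4`-chain. -/
lemma curvature_relations_of_lorentzForm {d₀ d₁ d₂ d₃ g G : Fin 4 → ℝ}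
    (h₀ : lorentzForm d₀ d₀ = 1) (h₁ : lorentzForm d₁ d₁ = 1) (h₂ : lorentzForm d₂ d₂ = 1)
    (h₃ : lorentzForm d₃ d₃ = 1) (hg : lorentzForm g g = 1) (hG : lorentzForm G G = 1)
    (h₀₁ : lorentzForm d₀ d₁ = -1) (h₁₂ : lorentzForm d₁ d₂ = -1)
    (h₂₃ : lorentzForm d₂ d₃ = -1) (h₃₀ : lorentzForm d₃ d₀ = -1)
    (h₀g : lorentzForm d₀ g = -1) (h₁g : lorentzForm d₁ g = -1)
    (h₂g : lorentzForm d₂ g = -1) (h₃g : lorentzForm d₃ g = -1)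
    (h₀G : lorentzForm d₀ G = -1) (h₁G : lorentzForm d₁ G = -1)
    (h₂G : lorentzForm d₂ G = -1) (h₃G : lorentzForm d₃ G = -1)
    (hgG : lorentzForm g G < -1) (h₀₂ : d₀ ≠ d₂) (h₁₃ : d₁ ≠ d₃) :
    d₀ 0 + d₂ 0 = g 0 + G 0 ∧ d₁ 0 + d₃ 0 = g 0 + G 0 ∧
      4 * (d₀ 0 * d₂ 0 + d₁ 0 * d₃ 0) = (G 0 - g 0) ^ 2 := by
  have sub_sub_self : ∀ u v, lorentzForm u u = 1 → lorentzForm v v = 1 →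
      lorentzForm (u - v) (u - v) = 2 - 2 * lorentzForm u v := by
    intro u v hu hv
    simp only [map_sub, LinearMap.sub_apply, hu, hv, lorentzForm_comm v u]
    ring
  have hpp : lorentzForm (g + G) (g + G) = 2 + 2 * lorentzForm g G := by
    simp only [map_add, LinearMap.add_apply, hg, hG, lorentzForm_comm G g]
    ring
  have hmm := sub_sub_self g G hg hG
  have hww := sub_sub_self d₀ d₂ h₀ h₂
  have hzz := sub_sub_self d₁ d₃ h₁ h₃
  have hp₀ : lorentzForm d₀ (g + G) = -2 := by rw [map_add, h₀g, h₀G]; norm_num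
  have hp₁ : lorentzForm d₁ (g + G) = -2 := by rw [map_add, h₁g, h₁G]; norm_num
  have hp₂ : lorentzForm d₂ (g + G) = -2 := by rw [map_add, h₂g, h₂G]; norm_num
  have hp₃ : lorentzForm d₃ (g + G) = -2 := by rw [map_add, h₃g, h₃G]; norm_num
  have hm₀ : lorentzForm d₀ (g - G) = 0 := by rw [map_sub, h₀g, h₀G, sub_self]
  have hm₁ : lorentzForm d₁ (g - G) = 0 := by rw [map_sub, h₁g, h₁G, sub_self]
  have hm₂ : lorentzForm d₂ (g - G) = 0 := by rw [map_sub, h₂g, h₂G, sub_self]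
  have hm₃ : lorentzForm d₃ (g - G) = 0 := by rw [map_sub, h₃g, h₃G, sub_self]
  have hz₀ : lorentzForm d₀ (d₁ - d₃) = 0 := by
    rw [map_sub, h₀₁, lorentzForm_comm, h₃₀, sub_self]
  have hz₂ : lorentzForm d₂ (d₁ - d₃) = 0 := by
    rw [map_sub, lorentzForm_comm, h₁₂, h₂₃, sub_self]
  have hw₁ : lorentzForm d₁ (d₀ - d₂) = 0 := by
    rw [map_sub, lorentzForm_comm, h₀₁, h₁₂, sub_self]
  have hw₀ : lorentzForm d₀ (d₀ - d₂) = 1 - lorentzForm d₀ d₂ := by rw [map_sub, h₀]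
  have hz₁ : lorentzForm d₁ (d₁ - d₃) = 1 - lorentzForm d₁ d₃ := by rw [map_sub, h₁]
  have hpm : lorentzForm (g + G) (g - G) = 0 := by
    simp only [map_add, map_sub, LinearMap.add_apply, hg, hG, lorentzForm_comm G g]
    ring
  have hpw : lorentzForm (g + G) (d₀ - d₂) = 0 := by
    rw [lorentzForm_comm, map_sub, LinearMap.sub_apply, hp₀, hp₂, sub_self]
  have hpz : lorentzForm (g + G) (d₁ - d₃) = 0 := by
    rw [lorentzForm_comm, map_sub, LinearMap.sub_apply, hp₁, hp₃, sub_self]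
  have hmw : lorentzForm (g - G) (d₀ - d₂) = 0 := by
    rw [lorentzForm_comm, map_sub lorentzForm, LinearMap.sub_apply, hm₀, hm₂, sub_self]
  have hmz : lorentzForm (g - G) (d₁ - d₃) = 0 := by
    rw [lorentzForm_comm, map_sub lorentzForm, LinearMap.sub_apply, hm₁, hm₃, sub_self]
  have hwz : lorentzForm (d₀ - d₂) (d₁ - d₃) = 0 := by
    rw [map_sub lorentzForm, LinearMap.sub_apply, hz₀, hz₂, sub_self]
  have hw : 0 < lorentzForm (d₀ - d₂) (d₀ - d₂) :=
    lorentzForm_self_pos_of_ortho (by linarith) hpw (sub_ne_zero.2 h₀₂)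
  have hz : 0 < lorentzForm (d₁ - d₃) (d₁ - d₃) :=
    lorentzForm_self_pos_of_ortho (by linarith) hpz (sub_ne_zero.2 h₁₃)
  have hs : 2 + 2 * lorentzForm g G ≠ 0 := by linarith
  have parseval := lorentzForm_eq_of_ortho (hpp.trans_ne hs) (by linarith) hw.ne' hz.ne'
    hpm hpw hpz hmw hmz hwz
  rw [hpp, hmm, hww, hzz] at parseval
  rw [hww] at hw
  rw [hzz] at hz
  -- Only the `g + G` term survives: `-1 = 4 / (2 + 2 * lorentzForm g G)`.
  have hk : lorentzForm g G = -3 := by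
    have h := parseval d₀ d₁
    rw [h₀₁, hp₀, hp₁, hm₀, hw₁, hz₀, zero_mul, zero_mul, mul_zero, zero_div, zero_div, zero_div,
      add_zero, add_zero, add_zero, eq_div_iff hs] at h
    linarith
  have half : ∀ t : ℝ, 0 < 2 - 2 * t → (1 - t) * (1 - t) / (2 - 2 * t) = (1 - t) / 2 := by
    intro t ht
    rw [div_eq_div_iff ht.ne' two_ne_zero]
    ring
  have hx : lorentzForm d₀ d₂ = -3 := by
    have h := parseval d₀ d₀
    rw [h₀, hp₀, hm₀, hw₀, hz₀, half _ hw, hk] at h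
    linear_combination 2 * h
  have hy : lorentzForm d₁ d₃ = -3 := by
    have h := parseval d₁ d₁
    rw [h₁, hp₁, hm₁, hw₁, hz₁, half _ hz, hk] at h
    linear_combination 2 * h
  -- the null vector representing the zeroth coordinate
  obtain ⟨n, hn, hn0⟩ : ∃ n : Fin 4 → ℝ, (∀ v, lorentzForm n v = v 0) ∧ n 0 = 0 := by
    refine ⟨![0, -2, 0, 0], fun v ↦ ?_, rfl⟩
    simp only [lorentzForm_apply, Matrix.cons_val]
    ring
  have e₀ := parseval n d₀
  have e₁ := parseval n d₁
  -- Since `n` is null, this is a quadratic relation among the curvatures alone.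
  have en := parseval n n
  simp only [hn, hn0, hp₀, hp₁, hm₀, hm₁, hw₀, hw₁, hz₀, hz₁, hk, hx, hy, Pi.add_apply,
    Pi.sub_apply] at e₀ e₁ en
  have s₀ : d₀ 0 + d₂ 0 = g 0 + G 0 := by linear_combination 2 * e₀
  have s₁ : d₁ 0 + d₃ 0 = g 0 + G 0 := by linear_combination 2 * e₁
  refine ⟨s₀, s₁, ?_⟩
  linear_combination 8 * en + (d₀ 0 + d₂ 0 + g 0 + G 0) * s₀ + (d₁ 0 + d₃ 0 + g 0 + G 0) * s₁

/-- A circle inside an open disk: the distance of the centres is less than the difference of the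
radii. -/
lemma dist_add_lt_of_sphere_subset_ball {E : Type*} [NormedAddCommGroup E] [NormedSpace ℝ E]
    [Nontrivial E] {x y : E} {r R : ℝ} (hr : 0 ≤ r)
    (h : Metric.sphere x r ⊆ Metric.ball y R) : dist x y + r < R := by
  -- With `u` pointing from `y` to `x`, `x + r • u` is the point of the sphere farthest from `y`.
  obtain ⟨u, hu, hxy⟩ : ∃ u : E, ‖u‖ = 1 ∧ x - y = ‖x - y‖ • u := by
    by_cases hxy : x - y = 0
    · obtain ⟨u, hu⟩ := exists_norm_eq E zero_le_one
      exact ⟨u, hu, by simp [hxy]⟩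
    · exact ⟨‖x - y‖⁻¹ • (x - y), norm_smul_inv_norm hxy,
        (smul_inv_smul₀ (norm_ne_zero_iff.2 hxy) _).symm⟩
  have hmem : x + r • u ∈ Metric.sphere x r := by
    simp [norm_smul, hu, abs_of_nonneg hr]
  have hlt := Metric.mem_ball.1 (h hmem)
  have heq : x + r • u - y = (‖x - y‖ + r) • u := by
    rw [add_smul, ← hxy]
    abel
  rwa [dist_eq_norm, heq, norm_smul, hu, mul_one, Real.norm_of_nonneg (by positivity),
    ← dist_eq_norm] at hlt

/-- In a Steiner `4`-chain the curvatures of opposite circles add up to the (signed) curvatures of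
the parents, and the products of opposite curvatures have a constant sum. -/
lemma IsSteinerChain.curvature_relations {γ Γ : PlaneCircle} {δ : Fin 4 → PlaneCircle}
    (h : IsSteinerChain γ Γ δ) :
    1 / (δ 0).radius + 1 / (δ 2).radius = 1 / γ.radius + 1 / -Γ.radius ∧
    1 / (δ 1).radius + 1 / (δ 3).radius = 1 / γ.radius + 1 / -Γ.radius ∧
    4 * (1 / (δ 0).radius * (1 / (δ 2).radius) + 1 / (δ 1).radius * (1 / (δ 3).radius)) =
      (1 / -Γ.radius - 1 / γ.radius) ^ 2 := by
  have hδ : ∀ i, (δ i).radius ≠ 0 := fun i ↦ (h.radius_pos i).ne'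
  have hγ := h.inner_radius_pos
  have hΓ := h.outer_radius_pos
  have hΓ' : -Γ.radius ≠ 0 := neg_ne_zero.2 hΓ.ne'
  let v : Fin 4 → Fin 4 → ℝ := fun i ↦ circleVec (δ i).center (δ i).radius
  have hself : ∀ i, lorentzForm (v i) (v i) = 1 := fun i ↦ lorentzForm_circleVec_self _ (hδ i)
  have hnext : ∀ i, lorentzForm (v i) (v (i + 1)) = -1 := fun i ↦
    lorentzForm_circleVec_of_dist_eq_add (hδ i) (hδ (i + 1)) (h.tangent_next i).dist_center
  have hin : ∀ i, lorentzForm (v i) (circleVec γ.center γ.radius) = -1 := fun i ↦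
    lorentzForm_circleVec_of_dist_eq_add (hδ i) hγ.ne' (h.tangent_inner i).dist_center
  have hout : ∀ i, lorentzForm (v i) (circleVec Γ.center (-Γ.radius)) = -1 := by
    intro i
    -- Internal tangency puts the centres at distance `R - ρ`, whose square is that of the signed
    -- sum `ρ + (-R)`.
    rw [lorentzForm_circleVec _ _ (hδ i) hΓ', (h.tangent_outer i).dist_center]
    have := hδ i
    field_simp
    ring
  have hinj : ∀ i j, i ≠ j → v i ≠ v j := by
    intro i j hij hv
    obtain ⟨hc, hr⟩ := circleVec_injective (hδ i) hv
    exact hij (h.distinct (EuclideanGeometry.Sphere.ext hc hr))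
  have hparents : lorentzForm (circleVec γ.center γ.radius)
      (circleVec Γ.center (-Γ.radius)) < -1 := by
    rw [lorentzForm_circleVec _ _ hγ.ne' hΓ', mul_neg, div_neg, neg_lt_neg_iff,
      one_lt_div (by positivity)]
    have hlt := dist_add_lt_of_sphere_subset_ball hγ.le h.nested
    nlinarith [dist_nonneg (x := γ.center) (y := Γ.center)]
  exact curvature_relations_of_lorentzForm (hself 0) (hself 1) (hself 2) (hself 3)
    (lorentzForm_circleVec_self _ hγ.ne') (lorentzForm_circleVec_self _ hΓ')
    (hnext 0) (hnext 1) (hnext 2) (hnext 3) (hin 0) (hin 1) (hin 2) (hin 3)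
    (hout 0) (hout 1) (hout 2) (hout 3) hparents (hinj 0 2 (by decide)) (hinj 1 3 (by decide))

theorem mainTheorem1 (γ Γ : PlaneCircle) (r R a A : ℝ)
    (hr : r = γ.radius) (hR : R = Γ.radius) (ha : a = 1 / r) (hA : A = -1 / R) :
    ∀ δ ∈ poristicFamily 4 γ Γ,
      (curvatureMoment 1 δ = 2 * (R - r) / (R * r) ∧
        curvatureMoment 1 δ = 2 * (A + a)) ∧
      (curvatureMoment 2 δ = (3 * R ^ 2 - 10 * R * r + 3 * r ^ 2) / (2 * R ^ 2 * r ^ 2) ∧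
        curvatureMoment 2 δ = (3 * A ^ 2 + 10 * A * a + 3 * a ^ 2) / 2) ∧
      (curvatureMoment 3 δ =
          (5 * R ^ 3 - 27 * R ^ 2 * r + 27 * R * r ^ 2 - 5 * r ^ 3) / (4 * R ^ 3 * r ^ 3) ∧
        curvatureMoment 3 δ =
          (5 * A ^ 3 + 27 * A ^ 2 * a + 27 * A * a ^ 2 + 5 * a ^ 3) / 4) := by
  intro δ hδ
  have hchain : IsSteinerChain γ Γ δ := hδ
  obtain ⟨h₀₂, h₁₃, hprod⟩ := hchain.curvature_relations
  have hr0 : r ≠ 0 := hr ▸ hchain.inner_radius_pos.ne'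
  have hR0 : R ≠ 0 := hR ▸ hchain.outer_radius_pos.ne'
  rw [← hr, ← hR, ← ha, one_div_neg_eq_neg_one_div, ← neg_div, ← hA] at h₀₂ h₁₃ hprod
  have e1 : curvatureMoment 1 δ = 2 * (A + a) := by
    simp only [curvatureMoment, Fin.sum_univ_four]
    linear_combination h₀₂ + h₁₃
  have e2 : curvatureMoment 2 δ = (3 * A ^ 2 + 10 * A * a + 3 * a ^ 2) / 2 := by
    simp only [curvatureMoment, Fin.sum_univ_four]
    linear_combination (1 / (δ 0).radius + 1 / (δ 2).radius + a + A) * h₀₂ +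
      (1 / (δ 1).radius + 1 / (δ 3).radius + a + A) * h₁₃ - hprod / 2
  have e3 : curvatureMoment 3 δ =
      (5 * A ^ 3 + 27 * A ^ 2 * a + 27 * A * a ^ 2 + 5 * a ^ 3) / 4 := by
    -- Both opposite pairs have the same sum `s`, so their products enter the third moment only
    -- through their total.
    have cube : ∀ x y s : ℝ, x + y = s → x ^ 3 + y ^ 3 = s ^ 3 - 3 * s * (x * y) := by
      rintro x y _ rfl
      ring
    simp only [curvatureMoment, Fin.sum_univ_four]
    linear_combination cube _ _ _ h₀₂ + cube _ _ _ h₁₃ - 3 / 4 * (a + A) * hprod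
  refine ⟨⟨e1.trans ?_, e1⟩, ⟨e2.trans ?_, e2⟩, ⟨e3.trans ?_, e3⟩⟩ <;>
    · rw [ha, hA]
      field_simp
      ring
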